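/- Let the structure be either $\mathbb N$ with $0$, $+1$, $<$ (logic S1S) or the set $\{0,1\}^*$ of binary words with $\varepsilon$, the two successors $u\mapsto u.0$, $u\mapsto u.1$ and the proper-prefix order $<$ (logic S2S), together with predicates $P_a$ given by a finite or infinite word (respectively labelled binary tree) over a finite alphabet. In S1S/S2S set variables range over all subsets of the domain; in the weak logics WS1S/WS2S every set variable ranges over finite subsets only. Let $r:\ x\to\psi(x,y),\,y$ be a monadic rule: $\psi$ is a monadic second-order formula with no free variables besides the distinct first-order variables $x,y$. The rule loops if there is an infinite sequence $a_0,a_1,\dots$ of domain elements with $\psi(a_n,a_{n+1})$ for all $n$. A recurrence set for $r$ is a non-empty set $X$ such that for every $a\in X$ there is $b\in X$ with $\psi(a,b)$. Let $\varphi_r$ be the sentence $$\exists X\,\bigl(\exists x\; x\in X\ \wedge\ \forall x\,\exists y\,(x\in X\Rightarrow[\psi(x,y)\wedge y\in X])\bigr).$$ Then: 1. The map $r\mapsto\varphi_r$ is computable. Hence, if $D$ is a decision procedure for the weak logic (a computable function that decides, for a given class $K$ of such structures of the chosen kind and alphabet, for example a single one or all of them, which sentences are true in every member of $K$ when read in the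 weak logic), then the test $r\mapsto D(\varphi_r)$ is computable; it accepts $r$ if and only if $\varphi_r$ is true, in the weak logic, in every member of $K$. If it accepts $r$, then in each member of $K$ there is a finite (non-empty) recurrence set for $r$ and $r$ loops, where $\psi$ is read in the weak logic; and the same holds with $\psi$ read in S1S (respectively S2S) whenever, in that structure, the relation defined by $\psi$ in the weak logic is contained in the one defined by $\psi$ in S1S (S2S). 2. In each such structure, $\varphi_r$ is true in the weak logic if and only if there is a finite recurrence set for $r$, $\psi$ being read in the weak logic. Whether $\psi$ is read in the weak logic or in S1S (S2S), if the formula following $\exists X$ in $\varphi_r$ holds for some finite set $X$, then there is a finite (non-empty) recurrence set for $r$ and $r$ loops, for that reading of $\psi$. If $\psi$ contains no set quantifier, the two readings of $\psi$ define the same relation. -/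

import Mathlib

namespace MSO

/-- The two logics: one successor (S1S) or two successors (S2S). -/
inductive Logic where
  | S1S
  | S2S

/-- Index set of the successor functions: a single one (`+1`), or the two functions `.0`, `.1`. -/
def Logic.Dir : Logic → Type
  | .S1S => Unit
  | .S2S => Bool

/-- The number of a successor function, used only for coding terms by numbers. -/
def Logic.dirCode : (L : Logic) → L.Dir → ℕ
  | .S1S, _ => 0
  | .S2S, d => Bool.toNat d

/-- Domain of the first-order variables: `ℕ` for S1S and the binary words `{0,1}*` for S2S. -/
def Logic.Pos : Logic → Type
  | .S1S => ℕ
  | .S2S => List Bool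

/-- The constant `0`, respectively the empty word. -/
def Logic.root : (L : Logic) → L.Pos
  | .S1S => (0 : ℕ)
  | .S2S => ([] : List Bool)

/-- The successor functions: `n ↦ n + 1`, respectively `u ↦ u.0` and `u ↦ u.1`. -/
def Logic.succ : (L : Logic) → L.Dir → L.Pos → L.Pos
  | .S1S, _, n => Nat.succ n
  | .S2S, d, u => List.append u [d]

/-- The order `<` on `ℕ`, respectively the proper-prefix relation on binary words. -/
def Logic.lt : (L : Logic) → L.Pos → L.Pos → Prop
  | .S1S, m, n => Nat.lt m n
  | .S2S, u, v => List.IsPrefix u v ∧ u ≠ v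

/-- Terms; first-order variables are named by natural numbers. -/
inductive Term (L : Logic) where
  | root : Term L
  | var (x : ℕ) : Term L
  | succ (d : L.Dir) (t : Term L) : Term L

/-- Formulas over an alphabet with `k` letters. First-order variables and set variables are
two separate sorts, each named by natural numbers. -/
inductive Formula (L : Logic) (k : ℕ) where
  | eq (t t' : Term L) : Formula L k
  | lt (t t' : Term L) : Formula L k
  | mem (t : Term L) (X : ℕ) : Formula L k
  | lab (a : Fin k) (t : Term L) : Formula L k
  | neg (φ : Formula L k) : Formula L k
  | and (φ ψ : Formula L k) : Formula L k
  | or (φ ψ : Formula L k) : Formula L k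
  | imp (φ ψ : Formula L k) : Formula L k
  | iff (φ ψ : Formula L k) : Formula L k
  | all₁ (x : ℕ) (φ : Formula L k) : Formula L k
  | ex₁ (x : ℕ) (φ : Formula L k) : Formula L k
  | all₂ (X : ℕ) (φ : Formula L k) : Formula L k
  | ex₂ (X : ℕ) (φ : Formula L k) : Formula L k

/-- Gödel number of a term. -/
def Term.code {L : Logic} : Term L → ℕ
  | .root => Nat.pair 0 0
  | .var x => Nat.pair 1 x
  | .succ d t => Nat.pair (2 + L.dirCode d) t.code

/-- Variables of a term. -/
def Term.vars {L : Logic} : Term L → Finset ℕ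
  | .root => ∅
  | .var x => {x}
  | .succ _ t => t.vars

/-- Gödel number of a formula. -/
def Formula.code {L : Logic} {k : ℕ} : Formula L k → ℕ
  | .eq t t' => Nat.pair 0 (Nat.pair t.code t'.code)
  | .lt t t' => Nat.pair 1 (Nat.pair t.code t'.code)
  | .mem t X => Nat.pair 2 (Nat.pair t.code X)
  | .lab a t => Nat.pair 3 (Nat.pair a.val t.code)
  | .neg φ => Nat.pair 4 φ.code
  | .and φ ψ => Nat.pair 5 (Nat.pair φ.code ψ.code)
  | .or φ ψ => Nat.pair 6 (Nat.pair φ.code ψ.code)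
  | .imp φ ψ => Nat.pair 7 (Nat.pair φ.code ψ.code)
  | .iff φ ψ => Nat.pair 8 (Nat.pair φ.code ψ.code)
  | .all₁ x φ => Nat.pair 9 (Nat.pair x φ.code)
  | .ex₁ x φ => Nat.pair 10 (Nat.pair x φ.code)
  | .all₂ X φ => Nat.pair 11 (Nat.pair X φ.code)
  | .ex₂ X φ => Nat.pair 12 (Nat.pair X φ.code)

theorem dirCode_injective (L : Logic) : Function.Injective L.dirCode := by
  cases L
  · intro a b _; rfl
  · intro a b h
    cases a <;> cases b <;> first | rfl | (simp [Logic.dirCode] at h)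

theorem Term.code_injective {L : Logic} : Function.Injective (Term.code (L := L)) := by
  intro s
  induction s with
  | root =>
    intro t h
    cases t with
    | root => rfl
    | var x => simp [Term.code, Nat.pair_eq_pair] at h
    | succ d t => simp only [Term.code, Nat.pair_eq_pair] at h; omega
  | var x =>
    intro t h
    cases t with
    | root => simp [Term.code, Nat.pair_eq_pair] at h
    | var y => simpa [Term.code, Nat.pair_eq_pair] using h
    | succ d t => simp only [Term.code, Nat.pair_eq_pair] at h; omega
  | succ d s ih =>
    intro t h
    cases t with
    | root => simp only [Term.code, Nat.pair_eq_pair] at h; omega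
    | var y => simp only [Term.code, Nat.pair_eq_pair] at h; omega
    | succ e t =>
      simp only [Term.code, Nat.pair_eq_pair] at h
      rw [dirCode_injective L (Nat.add_left_cancel h.1), ih h.2]

/-- Different formulas have different Gödel numbers. -/
theorem Formula.code_injective {L : Logic} {k : ℕ} :
    Function.Injective (Formula.code (L := L) (k := k)) := by
  intro φ
  induction φ with
  | eq t t' | lt t t' | mem t X | lab a t =>
    intro χ h
    cases χ <;> simp [Formula.code, Nat.pair_eq_pair, Term.code_injective.eq_iff] at h ⊢
    first | exact h | exact ⟨Fin.ext h.1, h.2⟩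
  | neg φ ih =>
    intro χ h
    cases χ <;> simp [Formula.code, Nat.pair_eq_pair] at h ⊢
    exact ih h
  | and φ ψ ih₁ ih₂ | or φ ψ ih₁ ih₂ | imp φ ψ ih₁ ih₂ | iff φ ψ ih₁ ih₂ =>
    intro χ h
    cases χ <;> simp [Formula.code, Nat.pair_eq_pair] at h ⊢
    exact ⟨ih₁ h.1, ih₂ h.2⟩
  | all₁ x φ ih | ex₁ x φ ih | all₂ x φ ih | ex₂ x φ ih =>
    intro χ h
    cases χ <;> simp [Formula.code, Nat.pair_eq_pair] at h ⊢
    exact ⟨h.1, ih h.2⟩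

/-- Free first-order variables. -/
def Formula.free₁ {L : Logic} {k : ℕ} : Formula L k → Finset ℕ
  | .eq t t' => t.vars ∪ t'.vars
  | .lt t t' => t.vars ∪ t'.vars
  | .mem t _ => t.vars
  | .lab _ t => t.vars
  | .neg φ => φ.free₁
  | .and φ ψ => φ.free₁ ∪ ψ.free₁
  | .or φ ψ => φ.free₁ ∪ ψ.free₁
  | .imp φ ψ => φ.free₁ ∪ ψ.free₁
  | .iff φ ψ => φ.free₁ ∪ ψ.free₁
  | .all₁ x φ => φ.free₁.erase x
  | .ex₁ x φ => φ.free₁.erase x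
  | .all₂ _ φ => φ.free₁
  | .ex₂ _ φ => φ.free₁

/-- Free set variables. -/
def Formula.free₂ {L : Logic} {k : ℕ} : Formula L k → Finset ℕ
  | .eq _ _ => ∅
  | .lt _ _ => ∅
  | .mem _ X => {X}
  | .lab _ _ => ∅
  | .neg φ => φ.free₂
  | .and φ ψ => φ.free₂ ∪ ψ.free₂
  | .or φ ψ => φ.free₂ ∪ ψ.free₂
  | .imp φ ψ => φ.free₂ ∪ ψ.free₂
  | .iff φ ψ => φ.free₂ ∪ ψ.free₂
  | .all₁ _ φ => φ.free₂
  | .ex₁ _ φ => φ.free₂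
  | .all₂ X φ => φ.free₂.erase X
  | .ex₂ X φ => φ.free₂.erase X

/-- A sentence is a formula without free variables. -/
def Formula.IsSentence {L : Logic} {k : ℕ} (σ : Formula L k) : Prop :=
  σ.free₁ = ∅ ∧ σ.free₂ = ∅

/-- The formula contains no quantifier over set variables. -/
def Formula.SetQuantFree {L : Logic} {k : ℕ} : Formula L k → Prop
  | .eq _ _ => True
  | .lt _ _ => True
  | .mem _ _ => True
  | .lab _ _ => True
  | .neg φ => φ.SetQuantFree
  | .and φ ψ => φ.SetQuantFree ∧ ψ.SetQuantFree
  | .or φ ψ => φ.SetQuantFree ∧ ψ.SetQuantFree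
  | .imp φ ψ => φ.SetQuantFree ∧ ψ.SetQuantFree
  | .iff φ ψ => φ.SetQuantFree ∧ ψ.SetQuantFree
  | .all₁ _ φ => φ.SetQuantFree
  | .ex₁ _ φ => φ.SetQuantFree
  | .all₂ _ _ => False
  | .ex₂ _ _ => False

/-- An interpretation: a finite or infinite word (respectively labelled binary tree) over an
alphabet with `k` letters. `label p = none` says that position `p` lies outside the word (tree);
the set of labelled positions is closed under passing to earlier positions (to prefixes).
The empty word (tree) is the unlabelled structure. -/
structure Interp (L : Logic) (k : ℕ) where
  label : L.Pos → Option (Fin k)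
  closed : ∀ p q, L.lt p q → (label q).isSome → (label p).isSome

/-- `full`: set variables range over all subsets of the domain (S1S, S2S).
`weak`: every set variable ranges over the finite subsets only (WS1S, WS2S). -/
inductive Range where
  | full
  | weak

/-- The sets over which set variables range. -/
def Range.Admits {α : Type} : Range → Set α → Prop
  | .full, _ => True
  | .weak, S => S.Finite

/-- Value of a term under an assignment of the first-order variables. -/
def Term.val {L : Logic} (v : ℕ → L.Pos) : Term L → L.Pos
  | .root => L.root
  | .var x => v x
  | .succ d t => L.succ d (t.val v)

/-- Satisfaction of a formula in an interpretation under assignments of the first-order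
variables and of the set variables. -/
def Formula.Sat {L : Logic} {k : ℕ} (R : Range) (M : Interp L k) :
    Formula L k → (ℕ → L.Pos) → (ℕ → Set L.Pos) → Prop
  | .eq t t', v, _ => t.val v = t'.val v
  | .lt t t', v, _ => L.lt (t.val v) (t'.val v)
  | .mem t X, v, V => t.val v ∈ V X
  | .lab a t, v, _ => M.label (t.val v) = some a
  | .neg φ, v, V => ¬ φ.Sat R M v V
  | .and φ ψ, v, V => φ.Sat R M v V ∧ ψ.Sat R M v V
  | .or φ ψ, v, V => φ.Sat R M v V ∨ ψ.Sat R M v V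
  | .imp φ ψ, v, V => φ.Sat R M v V → ψ.Sat R M v V
  | .iff φ ψ, v, V => (φ.Sat R M v V ↔ ψ.Sat R M v V)
  | .all₁ x φ, v, V => ∀ p : L.Pos, φ.Sat R M (Function.update v x p) V
  | .ex₁ x φ, v, V => ∃ p : L.Pos, φ.Sat R M (Function.update v x p) V
  | .all₂ X φ, v, V => ∀ S : Set L.Pos, R.Admits S → φ.Sat R M v (Function.update V X S)
  | .ex₂ X φ, v, V => ∃ S : Set L.Pos, R.Admits S ∧ φ.Sat R M v (Function.update V X S)

/-- A default assignment of the first-order variables. -/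
def point (L : Logic) : ℕ → L.Pos := fun _ => L.root

/-- A default assignment of the set variables. -/
def noSets (L : Logic) : ℕ → Set L.Pos := fun _ => ∅

/-- Truth of a sentence in an interpretation. -/
def Formula.Holds {L : Logic} {k : ℕ} (R : Range) (M : Interp L k) (σ : Formula L k) : Prop :=
  σ.Sat R M (point L) (noSets L)

/-- A monadic rule `x → ψ(x,y), y`: `x` and `y` are distinct first-order variables, and `ψ` is
a formula with no free variables besides `x` and `y`. -/
structure Rule (L : Logic) (k : ℕ) where
  x : ℕ
  y : ℕ
  ne : x ≠ y
  ψ : Formula L k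
  free₁ : ψ.free₁ ⊆ {x, y}
  free₂ : ψ.free₂ = ∅

/-- Gödel number of a rule. -/
def Rule.code {L : Logic} {k : ℕ} (r : Rule L k) : ℕ :=
  Nat.pair r.x (Nat.pair r.y r.ψ.code)

/-- The binary relation `ψ(a,b)` on positions. -/
def Rule.Rel {L : Logic} {k : ℕ} (R : Range) (M : Interp L k) (r : Rule L k)
    (a b : L.Pos) : Prop :=
  r.ψ.Sat R M (Function.update (Function.update (point L) r.x a) r.y b) (noSets L)

/-- The rule loops: some position starts an infinite computation. -/
def Rule.Loops {L : Logic} {k : ℕ} (R : Range) (M : Interp L k) (r : Rule L k) : Prop :=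
  ∃ s : ℕ → L.Pos, ∀ n, r.Rel R M (s n) (s (n + 1))

/-- `X` is a recurrence set for the rule. -/
def Rule.IsRecurrenceSet {L : Logic} {k : ℕ} (R : Range) (M : Interp L k) (r : Rule L k)
    (X : Set L.Pos) : Prop :=
  (∃ a, a ∈ X) ∧ ∀ a, ∃ b, a ∈ X → r.Rel R M a b ∧ b ∈ X

/-- The formula `∃x x ∈ X ∧ ∀x ∃y (x ∈ X ⇒ [ψ(x,y) ∧ y ∈ X])`, where `X` is the set
variable with name `0`. No capture can occur, as `ψ` has no free set variable. -/
def Rule.matrix {L : Logic} {k : ℕ} (r : Rule L k) : Formula L k :=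
  .and (.ex₁ r.x (.mem (.var r.x) 0))
    (.all₁ r.x (.ex₁ r.y (.imp (.mem (.var r.x) 0) (.and r.ψ (.mem (.var r.y) 0)))))

/-- The sentence `φ_r`, that is `∃X` followed by the formula above. -/
def Rule.φ {L : Logic} {k : ℕ} (r : Rule L k) : Formula L k := .ex₂ 0 r.matrix

/-- `D` is a decision procedure for the weak logic over the class `K` of interpretations: it is
computable, and it tells, given (the Gödel number of) a sentence, whether the sentence is
true in all members of `K` with all set variables ranging over finite sets. With `K` a singleton
this is the weak theory of one structure, with `K = Set.univ` it is validity. -/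
def IsWeakDecisionProcedure {L : Logic} {k : ℕ} (K : Set (Interp L k)) (D : ℕ → Bool) : Prop :=
  Computable D ∧
    ∀ σ : Formula L k, σ.IsSentence → (D σ.code = true ↔ ∀ M ∈ K, σ.Holds .weak M)

end MSO

namespace MSO

variable {L : Logic} {k : ℕ}

/-! The formula after `∃X` in `φ_r` says, for any set `X`, that `X` is a recurrence set
(`sat_matrix_iff`). In the weak logic `X` ranges over finite sets, so truth of `φ_r` there amounts
to a finite recurrence set (`φ_holds_iff`). A recurrence set forces looping: a choice of successors
never leaves it, so iterating from any element gives an infinite computation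
(`IsRecurrenceSet.loops`). Enlarging the relation keeps a recurrence set (`IsRecurrenceSet.mono`),
which carries the result from the weak to the full reading. On codes, `r ↦ φ_r` only wraps the code
of `ψ` in fixed pairings, hence is primitive recursive (`primrec_codeφ`). -/

/-- Satisfaction depends only on the values of the free set variables. -/
theorem Formula.sat_congr_sets {R : Range} {M : Interp L k} (φ : Formula L k) :
    ∀ {v : ℕ → L.Pos} {V W : ℕ → Set L.Pos}, (∀ X ∈ φ.free₂, V X = W X) →
      (φ.Sat R M v V ↔ φ.Sat R M v W) := by
  induction φ with
  | eq t t' | lt t t' | lab a t => intro v V W _; exact Iff.rfl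
  | mem t X =>
    intro v V W h
    simp only [Formula.Sat, h X (by simp [Formula.free₂])]
  | neg φ ih => intro v V W h; exact not_congr (ih h)
  | and φ ψ ih₁ ih₂ | or φ ψ ih₁ ih₂ | imp φ ψ ih₁ ih₂ | iff φ ψ ih₁ ih₂ =>
    intro v V W h
    simp only [Formula.free₂, Finset.mem_union] at h
    simp only [Formula.Sat, ih₁ fun X hX => h X (.inl hX), ih₂ fun X hX => h X (.inr hX)]
  | all₁ x φ ih => intro v V W h; exact forall_congr' fun _ => ih h
  | ex₁ x φ ih => intro v V W h; exact exists_congr fun _ => ih h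
  | all₂ X φ ih | ex₂ X φ ih =>
    intro v V W h
    -- After both updates the assignments agree at the bound name as well, so agreement off `X`
    -- suffices.
    have key (S : Set L.Pos) : φ.Sat R M v (Function.update V X S) ↔
        φ.Sat R M v (Function.update W X S) := by
      refine ih fun Y hY => ?_
      by_cases hYX : Y = X
      · subst hYX; simp
      · simpa [hYX] using h Y (Finset.mem_erase.2 ⟨hYX, hY⟩)
    simp only [Formula.Sat, key]

/-- Without set quantifiers the range of the set variables does not matter. -/
theorem Formula.SetQuantFree.sat_iff {R R' : Range} {M : Interp L k} {φ : Formula L k}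
    (hφ : φ.SetQuantFree) (v : ℕ → L.Pos) (V : ℕ → Set L.Pos) :
    φ.Sat R M v V ↔ φ.Sat R' M v V := by
  induction φ generalizing v with
  | eq t t' | lt t t' | lab a t | mem t X => exact Iff.rfl
  | neg φ ih => exact not_congr (ih hφ v)
  | and φ ψ ih₁ ih₂ | or φ ψ ih₁ ih₂ | imp φ ψ ih₁ ih₂ | iff φ ψ ih₁ ih₂ =>
    simp only [Formula.Sat, ih₁ hφ.1 v, ih₂ hφ.2 v]
  | all₁ x φ ih => exact forall_congr' fun _ => ih hφ _
  | ex₁ x φ ih => exact exists_congr fun _ => ih hφ _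
  | all₂ X φ ih | ex₂ X φ ih => exact hφ.elim

namespace Rule

/-- `φ_r` has no free variables. -/
theorem φ_isSentence (r : Rule L k) : r.φ.IsSentence := by
  constructor
  · ext z
    have hz := @r.free₁ z
    simp only [Finset.mem_insert, Finset.mem_singleton] at hz
    simp only [Rule.φ, Rule.matrix, Formula.free₁, Term.vars, Finset.mem_union,
      Finset.mem_erase, Finset.mem_singleton, Finset.notMem_empty, iff_false]
    tauto
  · ext z
    simp [Rule.φ, Rule.matrix, Formula.free₂, r.free₂]

/-- The formula following `∃X` in `φ_r` says that `X` is a recurrence set. -/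
theorem sat_matrix_iff (R : Range) (M : Interp L k) (r : Rule L k) (X : Set L.Pos) :
    r.matrix.Sat R M (point L) (Function.update (noSets L) 0 X) ↔ r.IsRecurrenceSet R M X := by
  -- The value of set variable `0` is invisible to `ψ`, even if `ψ` itself binds that name.
  have hψ (v : ℕ → L.Pos) : r.ψ.Sat R M v (Function.update (noSets L) 0 X) ↔
      r.ψ.Sat R M v (noSets L) :=
    r.ψ.sat_congr_sets fun Y hY => by simp [r.free₂] at hY
  -- The quantifiers over `x`, then `y`, build exactly the assignment used in `Rel`; `r.ne` ensures
  -- that updating `y` leaves the value of `x` intact.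
  simp [Rule.matrix, Formula.Sat, Term.val, hψ, Rule.IsRecurrenceSet, Rule.Rel, r.ne]

theorem φ_holds_iff (R : Range) (M : Interp L k) (r : Rule L k) :
    r.φ.Holds R M ↔ ∃ X : Set L.Pos, R.Admits X ∧ r.IsRecurrenceSet R M X :=
  exists_congr fun X => and_congr_right fun _ => r.sat_matrix_iff R M X

theorem IsRecurrenceSet.loops {R : Range} {M : Interp L k} {r : Rule L k} {X : Set L.Pos}
    (h : r.IsRecurrenceSet R M X) : r.Loops R M := by
  obtain ⟨⟨a, ha⟩, hX⟩ := h
  -- Since `∃ b` stands outside the implication, `f` is total and can be iterated; outside `X` its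
  -- values are arbitrary.
  choose f hf using hX
  have hmem (n : ℕ) : f^[n] a ∈ X := by
    induction n with
    | zero => exact ha
    | succ n ih =>
      rw [Function.iterate_succ_apply']
      exact (hf _ ih).2
  refine ⟨fun n => f^[n] a, fun n => ?_⟩
  simp only [Function.iterate_succ_apply']
  exact (hf _ (hmem n)).1

/-- The relation occurs only positively in the notion of recurrence set. -/
theorem IsRecurrenceSet.mono {R R' : Range} {M : Interp L k} {r : Rule L k} {X : Set L.Pos}
    (h : r.IsRecurrenceSet R M X) (hR : ∀ a b, r.Rel R M a b → r.Rel R' M a b) :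
    r.IsRecurrenceSet R' M X :=
  ⟨h.1, fun a => (h.2 a).imp fun b hb ha => (hb ha).imp_left (hR a b)⟩

/-- The map `r ↦ φ_r` on Gödel numbers. -/
def codeφ (n : ℕ) : ℕ :=
  let x := n.unpair.1
  let y := n.unpair.2.unpair.1
  let c := n.unpair.2.unpair.2
  -- The leading numbers of the pairs are the constructor tags of `Formula.code` and `Term.code`;
  -- the zeros are the name of the set variable.
  let memX := Nat.pair 2 (Nat.pair (Nat.pair 1 x) 0)
  let memY := Nat.pair 2 (Nat.pair (Nat.pair 1 y) 0)
  Nat.pair 12 (Nat.pair 0 (Nat.pair 5 (Nat.pair (Nat.pair 10 (Nat.pair x memX))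
    (Nat.pair 9 (Nat.pair x (Nat.pair 10 (Nat.pair y
      (Nat.pair 7 (Nat.pair memX (Nat.pair 5 (Nat.pair c memY)))))))))))

theorem codeφ_code (r : Rule L k) : codeφ r.code = r.φ.code := by
  simp [codeφ, Rule.code, Rule.φ, Rule.matrix, Formula.code, Term.code]

theorem primrec_codeφ : Primrec codeφ := by
  have pair {f g : ℕ → ℕ} (hf : Primrec f) (hg : Primrec g) :
      Primrec fun n => Nat.pair (f n) (g n) := Primrec₂.natPair.comp hf hg
  have num (m : ℕ) : Primrec fun _ : ℕ => m := Primrec.const m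
  have hx : Primrec fun n : ℕ => n.unpair.1 := Primrec.fst.comp Primrec.unpair
  have hyc : Primrec fun n : ℕ => n.unpair.2 := Primrec.snd.comp Primrec.unpair
  have hy : Primrec fun n : ℕ => n.unpair.2.unpair.1 := Primrec.fst.comp (Primrec.unpair.comp hyc)
  have hc : Primrec fun n : ℕ => n.unpair.2.unpair.2 := Primrec.snd.comp (Primrec.unpair.comp hyc)
  have mem {f : ℕ → ℕ} (hf : Primrec f) :
      Primrec fun n => Nat.pair 2 (Nat.pair (Nat.pair 1 (f n)) 0) :=
    pair (num 2) (pair (pair (num 1) hf) (num 0))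
  exact pair (num 12) (pair (num 0) (pair (num 5) (pair (pair (num 10) (pair hx (mem hx)))
    (pair (num 9) (pair hx (pair (num 10) (pair hy
      (pair (num 7) (pair (mem hx) (pair (num 5) (pair hc (mem hy))))))))))))

end Rule

end MSO

theorem mainTheorem2 (L : MSO.Logic) (k : ℕ) :
    -- decision procedures for the weak logic provide a computable sufficient condition
    (∃ T : ℕ → ℕ, Computable T ∧ (∀ r : MSO.Rule L k, T r.code = r.φ.code) ∧
      ∀ (K : Set (MSO.Interp L k)) (D : ℕ → Bool), MSO.IsWeakDecisionProcedure K D →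
        Computable (fun n => D (T n)) ∧
        ∀ r : MSO.Rule L k,
          (D (T r.code) = true ↔ ∀ M ∈ K, r.φ.Holds .weak M) ∧
          (D (T r.code) = true → ∀ M ∈ K,
            (∃ X : Set L.Pos, X.Finite ∧ r.IsRecurrenceSet .weak M X) ∧ r.Loops .weak M ∧
            ((∀ a b, r.Rel .weak M a b → r.Rel .full M a b) →
              (∃ X : Set L.Pos, X.Finite ∧ r.IsRecurrenceSet .full M X) ∧ r.Loops .full M))) ∧
    (∀ (M : MSO.Interp L k) (r : MSO.Rule L k),
      -- truth in the weak logic means that there is a finite recurrence set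
      (r.φ.Holds .weak M ↔ ∃ X : Set L.Pos, X.Finite ∧ r.IsRecurrenceSet .weak M X) ∧
      -- in either logic, if the formula holds with `X` ranging over finite sets, the rule loops
      (∀ R : MSO.Range,
        (∃ X : Set L.Pos, X.Finite ∧
          r.matrix.Sat R M (MSO.point L) (Function.update (MSO.noSets L) 0 X)) →
        (∃ X : Set L.Pos, X.Finite ∧ r.IsRecurrenceSet R M X) ∧ r.Loops R M) ∧
      -- both logics give the rule the same meaning if it has no set quantifier
      (r.ψ.SetQuantFree → ∀ a b, r.Rel .weak M a b ↔ r.Rel .full M a b)) := by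
  refine ⟨⟨MSO.Rule.codeφ, MSO.Rule.primrec_codeφ.to_comp, MSO.Rule.codeφ_code,
    fun K D hD => ⟨hD.1.comp MSO.Rule.primrec_codeφ.to_comp, fun r => ?_⟩⟩,
    fun M r => ⟨r.φ_holds_iff .weak M, fun R => ?_, fun h a b => h.sat_iff _ _⟩⟩
  · have hr : D (MSO.Rule.codeφ r.code) = true ↔ ∀ M ∈ K, r.φ.Holds .weak M := by
      rw [r.codeφ_code]
      exact hD.2 r.φ r.φ_isSentence
    refine ⟨hr, fun h M hM => ?_⟩
    obtain ⟨X, hfin, hX⟩ := (r.φ_holds_iff .weak M).1 (hr.1 h M hM)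
    exact ⟨⟨X, hfin, hX⟩, hX.loops, fun hR => ⟨⟨X, hfin, hX.mono hR⟩, (hX.mono hR).loops⟩⟩
  · rintro ⟨X, hfin, hX⟩
    -- Finiteness is carried separately here: for `R = .full` the range of set variables does not
    -- supply it.
    rw [r.sat_matrix_iff] at hX
    exact ⟨⟨X, hfin, hX⟩, hX.loops⟩
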